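/- Let $p\in[0,1]$. Consider the following binary channel with an erasing adversary. For blocklength $n$ the input is a word $\mathbf x\in\{0,1\}^n$ and the output is $\mathbf y\in\{0,1,\perp\}^n$, where $y_t=x_t$ if $z_t=0$ and $y_t=\perp$ if $z_t=1$; the state $\mathbf z\in\{0,1\}^n$ is chosen by the adversary. A strategy $\Gamma$ of the adversary is a family of conditional distributions $G(z_t\mid x_1,\dots,x_{t-1})$, $t=1,\dots,n$, so that the (possibly randomized) decision whether to erase bit $t$ depends only on bits $1$ through $t-1$ (one-bit delay); the strategy may depend on the code. It is admissible if $\sum_{t=1}^n z_t\le pn$ for every $\mathbf x$ and every $\mathbf z$ with $\prod_{t} G(z_t\mid x_1,\dots,x_{t-1})>0$. A code with stochastic encoding, of blocklength $n$ and with $M$ messages, consists of a randomized encoder $\Phi$, which assigns to each message $m\in\{1,\dots,M\}$ a random word $\Phi(m)\in\{0,1\}^n$, and a deterministic decoder $\psi:\{0,1,\perp\}^n\to\{0\}\cup\{1,\dots,M\}$. Its error probability on message $m$ against $\Gamma$ is $$P_{\mathrm{err}}(m,\Gamma)=\Pr[\psi(\mathbf y)\ne m]=\sum_{\mathbf y:\,\psi(\mathbf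 y)\neq m}\ \sum_{\mathbf x,\mathbf z\in\{0,1\}^n} W(\mathbf y\mid\mathbf x,\mathbf z)\,\Pr[\Phi(m)=\mathbf x]\,\prod_{t=1}^n G(z_t\mid x_1,\dots,x_{t-1}),$$ where $W(\mathbf y\mid\mathbf x,\mathbf z)$ is $1$ if $\mathbf y$ is the output for input $\mathbf x$ and state $\mathbf z$, and $0$ otherwise. Its maximum probability of error $P_{\mathrm{err}}$ is the supremum of $P_{\mathrm{err}}(m,\Gamma)$ over all messages $m$ and all admissible strategies $\Gamma$. A rate $R\ge 0$ is achievable if there is a sequence of codes, the $n$-th of blocklength $n$ with $2^{\lfloor nR\rfloor}$ messages, whose maximum probability of error tends to $0$ as $n\to\infty$. The capacity is the supremum of the set of achievable rates. Theorem. For every $p\in[0,1]$ the capacity of this channel is exactly $1-p$. -/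

import Mathlib

open scoped ENNReal BigOperators

noncomputable section

namespace OneBitDelay

/-- A code of blocklength `n` with `M` messages and stochastic encoding: the encoder maps each
message to a random binary word of length `n` (private randomness of the encoder), and the decoder
is a deterministic map from received words to messages. A received symbol `some b` is an unerased
bit and `none` is an erasure; the decoder output `none` declares a failure. -/
structure StochasticCode (n M : ℕ) where
  enc : Fin M → PMF (Fin n → Bool)
  dec : (Fin n → Option Bool) → Option (Fin M)

/-- The bits of `x` strictly before position `t`. Positions are counted from `0`, so this is what
an adversary with one bit of delay has seen when it decides about position `t`. -/
def past {n : ℕ} (x : Fin n → Bool) (t : Fin n) : Fin (t : ℕ) → Bool :=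
  fun s => x (Fin.castLE t.isLt.le s)

/-- A randomized adversarial strategy with one bit of delay: for each position `t`, a randomized
map from the bits strictly before `t` to the state at `t` (`true` means that the bit is erased). -/
abbrev Strategy (n : ℕ) : Type :=
  (t : Fin n) → (Fin (t : ℕ) → Bool) → PMF Bool

/-- The conditional probability of the state word `z` given that `x` is transmitted. -/
def stateProb {n : ℕ} (Γ : Strategy n) (x z : Fin n → Bool) : ℝ≥0∞ :=
  ∏ t : Fin n, Γ t (past x t) (z t)

/-- The cost of a state word: the number of erased positions. -/
def cost {n : ℕ} (z : Fin n → Bool) : ℕ :=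
  (Finset.univ.filter fun t => z t = true).card

/-- The strategy never erases more than `p * n` of the `n` bits. -/
def SatisfiesCost (p : ℝ) {n : ℕ} (Γ : Strategy n) : Prop :=
  ∀ x z : Fin n → Bool, stateProb Γ x z ≠ 0 → (cost z : ℝ) ≤ p * n

/-- The erasure channel for one symbol: the output is the input bit in state `false`, and the
erasure symbol in state `true`. -/
def symbolChannel (y : Option Bool) (x z : Bool) : ℝ≥0∞ :=
  if y = (if z = true then none else some x) then 1 else 0

/-- The extension of the channel to words of length `n`. -/
def wordChannel {n : ℕ} (y : Fin n → Option Bool) (x z : Fin n → Bool) : ℝ≥0∞ :=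
  ∏ t : Fin n, symbolChannel (y t) (x t) (z t)

/-- The probability of error on message `m` against the strategy `Γ`. -/
def errorProb {n M : ℕ} (C : StochasticCode n M) (m : Fin M) (Γ : Strategy n) : ℝ≥0∞ :=
  ∑ y ∈ Finset.univ.filter (fun y : Fin n → Option Bool => C.dec y ≠ some m),
    ∑ x : Fin n → Bool, ∑ z : Fin n → Bool,
      wordChannel y x z * C.enc m x * stateProb Γ x z

/-- The maximum probability of error: the worst case over the admissible strategies, which may be
chosen knowing the code, and over the messages. -/
def maxErrorProb (p : ℝ) {n M : ℕ} (C : StochasticCode n M) : ℝ≥0∞ :=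
  ⨆ (Γ : Strategy n) (_ : SatisfiesCost p Γ) (m : Fin M), errorProb C m Γ

/-- The rates `R ≥ 0` for which some sequence of codes, the `n`-th one of blocklength `n` with
`2 ^ ⌊n R⌋` messages, has maximum probability of error tending to `0`. -/
def achievableRates (p : ℝ) : Set ℝ :=
  {R | 0 ≤ R ∧ ∃ C : (n : ℕ) → StochasticCode n (2 ^ ⌊(n : ℝ) * R⌋₊),
    Filter.Tendsto (fun n => maxErrorProb p (C n)) Filter.atTop (nhds 0)}

/-- `c` is the capacity, that is, the supremum of the (nonempty and bounded) set of achievable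
rates. -/
def IsCapacity (p c : ℝ) : Prop :=
  IsLUB (achievableRates p) c

end OneBitDelay

end

/-!
Achievability. A message is sent as `n` independent coins, one per bit: the encoder's randomness is
an independent, slightly unpredictable choice at every position. The coins come from a large finite
alphabet of different small biases, half of them in favour of each bit, and a random code assigns
them to the messages (`exists_code`). Since the alphabet is large, two messages use the same coin at
only a small fraction of the positions; since the coins are almost deterministic, any somewhat more
than `n R` received bits are plausible for boundedly many messages only.

The decoder splits the unerased positions into a head, slightly longer than `n R`, and a tail of
length linear in `n`. The head singles out boundedly many plausible messages, and the tail decides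
between them by likelihood. The adversary may know the message, its rivals and all their coins, and
can erase the positions that favour the transmitted message most; but there are too few positions
where a rival has the same coin to fill the tail with them. At every other unerased position of the
tail the adversary commits itself before the coin is thrown, so the square root of the likelihood
ratio of the rival shrinks on average by a constant factor. This is where the delay of one bit is
used, in the form of the supermartingale bound `sum_pathWeight_mul_le`. It yields
`sum_implausible_le` (the transmitted message is plausible on the head) and `sum_rival_le` (no
plausible rival wins on the tail), and with suitable parameters `mem_achievableRates`.

Converse. The adversary erases the first `⌊p n⌋` bits. The decoder then sees at most
`2 ^ (n - ⌊p n⌋)` different words, so above rate `1 - p` some message is never decoded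
(`achievableRates_le`).
-/

open scoped ENNReal BigOperators

noncomputable section

namespace OneBitDelay

/-! ### The channel output -/

/-- The received word when `x` is sent and the positions marked by `z` are erased. -/
def output {n : ℕ} (x z : Fin n → Bool) : Fin n → Option Bool :=
  fun t => if z t = true then none else some (x t)

lemma wordChannel_eq {n : ℕ} (y : Fin n → Option Bool) (x z : Fin n → Bool) :
    wordChannel y x z = if y = output x z then 1 else 0 := by
  unfold wordChannel symbolChannel
  rw [Finset.prod_ite_zero]
  simp [funext_iff, output]

lemma errorProb_eq {n M : ℕ} (C : StochasticCode n M) (m : Fin M) (Γ : Strategy n) :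
    errorProb C m Γ = ∑ x : Fin n → Bool, ∑ z : Fin n → Bool,
      if C.dec (output x z) ≠ some m then C.enc m x * stateProb Γ x z else 0 := by
  unfold errorProb
  rw [Finset.sum_comm]
  refine Finset.sum_congr rfl fun x _ => ?_
  rw [Finset.sum_comm]
  refine Finset.sum_congr rfl fun z _ => ?_
  simp_rw [wordChannel_eq, mul_assoc, ite_mul, one_mul, zero_mul]
  rw [Finset.sum_ite_eq']
  simp

/-! ### The converse -/

/-- The strategy that erases the first `e` bits, whatever is sent. -/
def eraseFirst (n e : ℕ) : Strategy n := fun t _ => PMF.pure (decide ((t : ℕ) < e))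

lemma stateProb_eraseFirst {n e : ℕ} (x z : Fin n → Bool) :
    stateProb (eraseFirst n e) x z =
      if z = fun t : Fin n => decide ((t : ℕ) < e) then 1 else 0 := by
  unfold stateProb eraseFirst
  split_ifs with h
  · subst h
    simp
  · obtain ⟨t, ht⟩ := Function.ne_iff.1 h
    exact Finset.prod_eq_zero (Finset.mem_univ t) (by simpa using ht)

lemma satisfiesCost_eraseFirst {n e : ℕ} {p : ℝ} (he : (e : ℝ) ≤ p * n) :
    SatisfiesCost p (eraseFirst n e) := by
  intro x z h
  rw [stateProb_eraseFirst] at h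
  have hz : z = fun t : Fin n => decide ((t : ℕ) < e) := by
    by_contra hz
    simp [hz] at h
  refine le_trans ?_ he
  have hcard : cost z ≤ (Finset.range e).card := by
    unfold cost
    refine Finset.card_le_card_of_injOn (fun t : Fin n => (t : ℕ)) ?_ ?_
    · intro t ht
      simpa [hz] using ht
    · intro a _ b _ hab
      exact Fin.ext hab
  rw [Finset.card_range] at hcard
  exact_mod_cast hcard

/-- If there are more messages than words of `n - e` bits, then some message is never decoded
against the erasure of the first `e` bits. -/
lemma one_le_maxErrorProb {n M e : ℕ} {p : ℝ} (C : StochasticCode n M) (he : (e : ℝ) ≤ p * n)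
    (hM : 2 ^ (n - e) < M) : 1 ≤ maxErrorProb p C := by
  let D : (Fin (n - e) → Bool) → Option (Fin M) := fun v =>
    C.dec fun t => if h : e ≤ (t : ℕ) then some (v ⟨t - e, by omega⟩) else none
  have hD : ∀ x, C.dec (output x fun t : Fin n => decide ((t : ℕ) < e)) =
      D fun s => x ⟨s + e, by omega⟩ := by
    intro x
    simp only [D]
    congr 1
    funext t
    by_cases h : e ≤ (t : ℕ)
    · have h' : ¬ ((t : ℕ) < e) := by omega
      simp [output, h, h', Nat.sub_add_cancel h]
    · have h' : (t : ℕ) < e := by omega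
      simp [output, h, h']
  obtain ⟨m, hm⟩ : ∃ m : Fin M, ∀ v, D v ≠ some m := by
    by_contra! hcon
    choose f hf using hcon
    have hinj : Function.Injective f := by
      intro a b hab
      have := hf a
      rw [hab, hf b] at this
      exact (Option.some_injective _ this).symm
    have := Fintype.card_le_of_injective f hinj
    simp at this
    omega
  have herr : errorProb C m (eraseFirst n e) = 1 := by
    rw [errorProb_eq, ← (C.enc m).tsum_coe, tsum_fintype]
    refine Finset.sum_congr rfl fun x _ => ?_
    rw [Finset.sum_eq_single (fun t : Fin n => decide ((t : ℕ) < e))]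
    · simp [hD, hm, stateProb_eraseFirst]
    · intro z _ hz
      simp [stateProb_eraseFirst, hz]
    · simp
  rw [← herr]
  exact le_iSup_of_le (eraseFirst n e)
    (le_iSup_of_le (satisfiesCost_eraseFirst he) (le_iSup_of_le m le_rfl))

lemma achievableRates_le {p R : ℝ} (hp0 : 0 ≤ p) (hp1 : p ≤ 1) (hR : R ∈ achievableRates p) :
    R ≤ 1 - p := by
  obtain ⟨hR0, C, hC⟩ := hR
  by_contra! hlt
  have hsmall := (ENNReal.tendsto_nhds_zero.1 hC) (1 / 2) (by simp)
  obtain ⟨k, hk⟩ := exists_nat_gt (2 / (R - (1 - p)))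
  obtain ⟨n, hn, hnk⟩ := (hsmall.and (Filter.eventually_ge_atTop k)).exists
  have hgap : 2 < n * (R - (1 - p)) := by
    have hkn : (k : ℝ) ≤ n := by exact_mod_cast hnk
    have := (div_lt_iff₀ (by linarith)).1 (hk.trans_le hkn)
    linarith
  have he : ((⌊p * n⌋₊ : ℕ) : ℝ) ≤ p * n := Nat.floor_le (by positivity)
  have hlt' : n - ⌊p * n⌋₊ < ⌊(n : ℝ) * R⌋₊ := by
    have h1 := Nat.lt_floor_add_one (p * n)
    have h2 := Nat.lt_floor_add_one ((n : ℝ) * R)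
    have hle : ⌊p * n⌋₊ ≤ n := by
      have : (⌊p * n⌋₊ : ℝ) ≤ n := he.trans (by nlinarith [(Nat.cast_nonneg n : (0 : ℝ) ≤ n)])
      exact_mod_cast this
    have : ((n - ⌊p * n⌋₊ : ℕ) : ℝ) < ⌊(n : ℝ) * R⌋₊ := by
      rw [Nat.cast_sub hle]
      nlinarith
    exact_mod_cast this
  have hone := one_le_maxErrorProb (C n) he (Nat.pow_lt_pow_right (by norm_num) hlt')
  have := hone.trans hn
  norm_num at this

/-- At rate `0` there is one message, and a constant decoder is always right. -/
lemma zero_mem_achievableRates (p : ℝ) : (0 : ℝ) ∈ achievableRates p := by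
  refine ⟨le_rfl, fun n => ⟨fun _ => PMF.pure fun _ => false, fun _ => some ⟨0, by simp⟩⟩, ?_⟩
  refine tendsto_const_nhds.congr fun n => ?_
  symm
  simp only [maxErrorProb, ENNReal.iSup_eq_zero]
  intro Γ _ m
  have hm : m = ⟨0, by simp⟩ := by
    have h2 := m.2
    ext
    simp at h2 ⊢
    omega
  subst hm
  simp [errorProb_eq]

/-! ### Random codes -/

lemma card_mul_sum_eq_sum_update {ι A : Type*} [Fintype ι] [DecidableEq ι] [Fintype A]
    (i : ι) (g : (ι → A) → ℝ) :
    (Fintype.card A : ℝ) * ∑ w, g w = ∑ w : ι → A, ∑ a, g (Function.update w i a) := by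
  classical
  -- `(w, a) ↦ (update w i a, w i)` is an involution.
  have hinv : Function.Involutive
      (fun u : (ι → A) × A => (Function.update u.1 i u.2, u.1 i)) := by
    intro u
    simp
  rw [← Fintype.sum_prod_type' fun (w : ι → A) (a : A) => g (Function.update w i a)]
  have := Equiv.sum_comp hinv.toPerm fun u : (ι → A) × A => g u.1
  simp only [Function.Involutive.coe_toPerm] at this
  rw [this, Fintype.sum_prod_type]
  simp [Finset.mul_sum]

/-- Two letters of a uniformly random word agree with probability `1 / card A`; an agreement is
given weight `card A`, and the mean weight is then at most `2`. -/
lemma sum_agreement_le {ι A : Type*} [Fintype ι] [DecidableEq ι] [Fintype A] [DecidableEq A]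
    [Nonempty A] {i j : ι} (hij : i ≠ j) :
    ∑ w : ι → A, (if w i = w j then (Fintype.card A : ℝ) else 1)
      ≤ 2 * (Fintype.card A : ℝ) ^ Fintype.card ι := by
  have hA : (0 : ℝ) < Fintype.card A := by exact_mod_cast Fintype.card_pos
  refine le_of_mul_le_mul_left ?_ hA
  rw [card_mul_sum_eq_sum_update i]
  calc ∑ w : ι → A, ∑ a, (if Function.update w i a i = Function.update w i a j
          then (Fintype.card A : ℝ) else 1)
      ≤ ∑ w : ι → A, 2 * (Fintype.card A : ℝ) := by
        refine Finset.sum_le_sum fun w _ => ?_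
        simp only [Function.update_self, Function.update_of_ne hij.symm]
        calc ∑ a, (if a = w j then (Fintype.card A : ℝ) else 1)
            ≤ ∑ a, ((if a = w j then (Fintype.card A : ℝ) else 0) + 1) := by
              refine Finset.sum_le_sum fun a _ => ?_
              split_ifs <;> linarith
          _ = 2 * (Fintype.card A : ℝ) := by
              rw [Finset.sum_add_distrib]
              simp
              ring
    _ = _ := by
        simp
        ring

lemma sum_prod_mem {ι A : Type*} [Fintype ι] [DecidableEq ι] [Fintype A]
    (S : Finset ι) (f : A → ℝ) (hf : ∑ a, f a = Fintype.card A / 2) :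
    ∑ w : ι → A, ∏ i ∈ S, f (w i) = (Fintype.card A : ℝ) ^ Fintype.card ι * (1 / 2) ^ S.card := by
  calc ∑ w : ι → A, ∏ i ∈ S, f (w i)
      = ∑ w : ι → A, ∏ i, (if i ∈ S then f (w i) else 1) := by
        refine Finset.sum_congr rfl fun w _ => ?_
        rw [Finset.prod_ite_mem, Finset.univ_inter]
    _ = ∏ i, ∑ a : A, (if i ∈ S then f a else 1) := by
        rw [Fintype.prod_sum]
    _ = ∏ i : ι, (Fintype.card A : ℝ) * (if i ∈ S then 1 / 2 else 1) := by
        refine Finset.prod_congr rfl fun i _ => ?_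
        split_ifs
        · rw [hf]; ring
        · simp
    _ = _ := by
        rw [Finset.prod_mul_distrib, Finset.prod_ite_mem, Finset.univ_inter]
        simp

/-- The likelihood of the word `x` on the positions in `U`, when position `t` is a coin of law
`q (a t)`. -/
def lik {n : ℕ} {A : Type*} (q : A → Bool → ℝ) (a : Fin n → A) (U : Finset (Fin n))
    (x : Fin n → Bool) : ℝ :=
  ∏ t ∈ U, q (a t) (x t)

/-- First-moment existence of a code `c` (whose `t`-th column `c t` lists the letters that the
messages have at position `t`) in which different messages agree in at most `d` positions, and in
which no word is plausible for more than `ℓ` messages at any `N` positions. -/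
theorem exists_code {A : Type*} [Fintype A] [DecidableEq A] [Nonempty A] (q : A → Bool → ℝ)
    (hq : ∀ a b, 0 ≤ q a b) (hbal : ∀ b, ∑ a, q a b = Fintype.card A / 2)
    (n M N d ℓ : ℕ)
    (hnum : (M : ℝ) * M * (2 ^ n / (Fintype.card A : ℝ) ^ (d + 1)) +
      2 ^ n * 2 ^ n * ((M : ℝ) ^ (ℓ + 1) * (2 ^ d * (1 / 2) ^ N) ^ (ℓ + 1)) < 1) :
    ∃ c : Fin n → Fin M → A,
      (∀ m m', m ≠ m' → (Finset.univ.filter fun t => c t m = c t m').card ≤ d) ∧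
      (∀ U : Finset (Fin n), U.card = N → ∀ x : Fin n → Bool,
        (Finset.univ.filter fun m => (1 / 2 : ℝ) ^ d ≤ lik q (fun t => c t m) U x).card ≤ ℓ) := by
  classical
  set α : ℝ := (Fintype.card A : ℝ) with hα
  have hα1 : (1 : ℝ) ≤ α := by
    rw [hα]; exact_mod_cast Nat.succ_le_of_lt (Fintype.card_pos (α := A))
  have hα0 : (0 : ℝ) < α := by linarith
  -- `F` charges a code for pairs of messages with too many agreements, `H` for lists that are too
  -- long; each violation is charged at least `1`.
  let F : (Fin n → Fin M → A) → Fin M → Fin M → ℝ := fun c m m' =>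
    if m = m' then 0 else (∏ t, if c t m = c t m' then α else 1) / α ^ (d + 1)
  let H : (Fin n → Fin M → A) → Finset (Fin n) → (Fin n → Bool) → Finset (Fin M) → ℝ :=
    fun c U x S => ∏ m ∈ S, (2 ^ d * lik q (fun t => c t m) U x)
  have hlik : ∀ (c : Fin n → Fin M → A) m U x, 0 ≤ lik q (fun t => c t m) U x :=
    fun c m U x => Finset.prod_nonneg fun t _ => hq _ _
  have hF0 : ∀ c m m', 0 ≤ F c m m' := by
    intro c m m'
    simp only [F]
    split_ifs
    · exact le_rfl
    · refine div_nonneg (Finset.prod_nonneg fun t _ => ?_) (by positivity)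
      split_ifs <;> linarith
  have hH0 : ∀ c U x S, 0 ≤ H c U x S := fun c U x S =>
    Finset.prod_nonneg fun m _ => mul_nonneg (by positivity) (hlik _ _ _ _)
  have hcard : (Fintype.card (Fin n → Fin M → A) : ℝ) = (α ^ M) ^ n := by
    simp [hα]
  have hFsum : ∀ m m', ∑ c, F c m m' ≤ (α ^ M) ^ n * (2 ^ n / α ^ (d + 1)) := by
    intro m m'
    by_cases hm : m = m'
    · simp only [F, hm, if_true, Finset.sum_const_zero]
      positivity
    · simp only [F, hm, if_false]
      rw [← Finset.sum_div, mul_div_assoc']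
      refine div_le_div_of_nonneg_right ?_ (by positivity)
      have := Fintype.prod_sum fun (_ : Fin n) (w : Fin M → A) =>
        if w m = w m' then α else (1 : ℝ)
      rw [← this, ← mul_pow]
      refine (Finset.prod_le_prod (g := fun _ => 2 * α ^ M) (fun t _ => ?_)
        fun t _ => ?_).trans_eq ?_
      · refine Finset.sum_nonneg fun w _ => ?_
        split_ifs <;> linarith
      · simpa using sum_agreement_le (A := A) hm
      · simp [mul_comm]
  have hHsum : ∀ U ∈ Finset.powersetCard N (Finset.univ : Finset (Fin n)), ∀ x,
      ∀ S ∈ Finset.powersetCard (ℓ + 1) (Finset.univ : Finset (Fin M)),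
      ∑ c, H c U x S = (α ^ M) ^ n * (2 ^ d * (1 / 2) ^ N) ^ (ℓ + 1) := by
    intro U hU x S hS
    rw [Finset.mem_powersetCard_univ] at hU hS
    have hH : ∀ c, H c U x S =
        (2 ^ d) ^ (ℓ + 1) * ∏ t, (if t ∈ U then ∏ m ∈ S, q (c t m) (x t) else 1) := by
      intro c
      simp only [H, lik]
      rw [Finset.prod_mul_distrib, Finset.prod_const, hS, Finset.prod_comm, Finset.prod_ite_mem,
        Finset.univ_inter]
    simp_rw [hH]
    rw [← Finset.mul_sum]
    have := Fintype.prod_sum fun (t : Fin n) (w : Fin M → A) =>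
      if t ∈ U then ∏ m ∈ S, q (w m) (x t) else 1
    rw [← this]
    have hcol : ∀ t : Fin n, (∑ w : Fin M → A, if t ∈ U then ∏ m ∈ S, q (w m) (x t) else 1) =
        α ^ M * (if t ∈ U then (1 / 2) ^ (ℓ + 1) else 1) := by
      intro t
      split_ifs
      · rw [sum_prod_mem S (fun a => q a (x t)) (hbal _), hS]
        simp [hα]
      · simp [hα]
    simp_rw [hcol]
    rw [Finset.prod_mul_distrib, Finset.prod_ite_mem, Finset.univ_inter, Finset.prod_const,
      Finset.prod_const, hU]
    simp only [Finset.card_univ, Fintype.card_fin]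
    rw [mul_pow, ← pow_mul ((1 : ℝ) / 2) N, mul_comm N, pow_mul]
    ring
  let T : (Fin n → Fin M → A) → ℝ := fun c => (∑ m, ∑ m', F c m m') +
    ∑ U ∈ Finset.powersetCard N (Finset.univ : Finset (Fin n)), ∑ x : Fin n → Bool,
      ∑ S ∈ Finset.powersetCard (ℓ + 1) (Finset.univ : Finset (Fin M)), H c U x S
  have hT : ∑ c, T c < ∑ c : Fin n → Fin M → A, (1 : ℝ) := by
    simp only [Finset.sum_const, nsmul_eq_mul, mul_one, Finset.card_univ, hcard]
    have h1 : ∑ c, ∑ m, ∑ m', F c m m' ≤ M * (M * ((α ^ M) ^ n * (2 ^ n / α ^ (d + 1)))) := by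
      rw [Finset.sum_comm]
      refine (Finset.sum_le_card_nsmul _ _ (M * ((α ^ M) ^ n * (2 ^ n / α ^ (d + 1))))
        fun m _ => ?_).trans_eq (by simp)
      rw [Finset.sum_comm]
      exact (Finset.sum_le_card_nsmul _ _ _ fun m' _ => hFsum m m').trans_eq (by simp)
    have h2 : ∑ c, ∑ U ∈ Finset.powersetCard N (Finset.univ : Finset (Fin n)),
        ∑ x : Fin n → Bool, ∑ S ∈ Finset.powersetCard (ℓ + 1) (Finset.univ : Finset (Fin M)),
          H c U x S
        ≤ 2 ^ n * (2 ^ n * (M ^ (ℓ + 1) *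
          ((α ^ M) ^ n * (2 ^ d * (1 / 2) ^ N) ^ (ℓ + 1)))) := by
      have hval : 0 ≤ (α ^ M) ^ n * ((2 : ℝ) ^ d * (1 / 2) ^ N) ^ (ℓ + 1) := by positivity
      have hchoose : ((M.choose (ℓ + 1) : ℕ) : ℝ) ≤ M ^ (ℓ + 1) := by
        exact_mod_cast Nat.choose_le_pow M (ℓ + 1)
      have hchoose' : ((n.choose N : ℕ) : ℝ) ≤ 2 ^ n := by
        exact_mod_cast Nat.choose_le_two_pow n N
      rw [Finset.sum_comm]
      refine (Finset.sum_le_card_nsmul _ _ (2 ^ n * (M ^ (ℓ + 1) *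
          ((α ^ M) ^ n * (2 ^ d * (1 / 2) ^ N) ^ (ℓ + 1)))) fun U hU => ?_).trans ?_
      · rw [Finset.sum_comm]
        refine (Finset.sum_le_card_nsmul _ _ (M ^ (ℓ + 1) *
          ((α ^ M) ^ n * (2 ^ d * (1 / 2) ^ N) ^ (ℓ + 1))) fun x _ => ?_).trans_eq (by simp)
        rw [Finset.sum_comm, Finset.sum_congr rfl fun S hS => hHsum U hU x S hS]
        simp only [Finset.sum_const, Finset.card_powersetCard, Finset.card_univ,
          Fintype.card_fin, nsmul_eq_mul]
        gcongr
      · simp only [Finset.card_powersetCard, Finset.card_univ, Fintype.card_fin, nsmul_eq_mul]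
        gcongr
    simp only [T, Finset.sum_add_distrib]
    calc _ ≤ _ := add_le_add h1 h2
      _ = (α ^ M) ^ n * ((M : ℝ) * M * (2 ^ n / α ^ (d + 1)) +
          2 ^ n * 2 ^ n * ((M : ℝ) ^ (ℓ + 1) * (2 ^ d * (1 / 2) ^ N) ^ (ℓ + 1))) := by ring
      _ < (α ^ M) ^ n * 1 := by gcongr
      _ = (α ^ M) ^ n := mul_one _
  obtain ⟨c, -, hc⟩ := Finset.exists_lt_of_sum_lt hT
  have hA0 : 0 ≤ ∑ m, ∑ m', F c m m' :=
    Finset.sum_nonneg fun m _ => Finset.sum_nonneg fun m' _ => hF0 c m m'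
  have hB0 : 0 ≤ ∑ U ∈ Finset.powersetCard N (Finset.univ : Finset (Fin n)),
      ∑ x : Fin n → Bool, ∑ S ∈ Finset.powersetCard (ℓ + 1) (Finset.univ : Finset (Fin M)),
        H c U x S :=
    Finset.sum_nonneg fun U _ => Finset.sum_nonneg fun x _ => Finset.sum_nonneg fun S _ =>
      hH0 c U x S
  refine ⟨c, fun m m' hm => ?_, fun U hU x => ?_⟩
  · by_contra! hcon
    have h1 : 1 ≤ F c m m' := by
      simp only [F, hm, if_false]
      rw [one_le_div (by positivity), Finset.prod_ite, Finset.prod_const, Finset.prod_const_one,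
        mul_one]
      exact pow_le_pow_right₀ hα1 hcon
    have h2 : F c m m' ≤ ∑ m, ∑ m', F c m m' :=
      (Finset.single_le_sum (f := fun m' => F c m m') (fun m' _ => hF0 c m m')
        (Finset.mem_univ m')).trans
      (Finset.single_le_sum (f := fun m => ∑ m', F c m m')
        (fun m _ => Finset.sum_nonneg fun m' _ => hF0 c m m') (Finset.mem_univ m))
    linarith
  · by_contra! hcon
    obtain ⟨S, hSsub, hS⟩ := Finset.exists_subset_card_eq (Nat.succ_le_of_lt hcon)
    have h1 : 1 ≤ H c U x S := by
      rw [← Finset.prod_const_one (s := S)]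
      refine Finset.prod_le_prod (fun _ _ => zero_le_one) fun m hm => ?_
      have := (Finset.mem_filter.1 (hSsub hm)).2
      calc (1 : ℝ) = 2 ^ d * (1 / 2) ^ d := by rw [← mul_pow]; norm_num
        _ ≤ _ := by gcongr
    have hU' : U ∈ Finset.powersetCard N (Finset.univ : Finset (Fin n)) := by simpa using hU
    have hS' : S ∈ Finset.powersetCard (ℓ + 1) (Finset.univ : Finset (Fin M)) := by simpa using hS
    have h2 : H c U x S ≤ _ :=
      (Finset.single_le_sum (f := fun S => H c U x S) (fun S _ => hH0 c U x S) hS').trans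
      ((Finset.single_le_sum (f := fun x => ∑ S ∈ Finset.powersetCard (ℓ + 1)
        (Finset.univ : Finset (Fin M)), H c U x S)
        (fun x _ => Finset.sum_nonneg fun S _ => hH0 c U x S) (Finset.mem_univ x)).trans
      (Finset.single_le_sum (f := fun U => ∑ x, ∑ S ∈ Finset.powersetCard (ℓ + 1)
        (Finset.univ : Finset (Fin M)), H c U x S)
        (fun U _ => Finset.sum_nonneg fun x _ => Finset.sum_nonneg fun S _ => hH0 c U x S) hU'))
    linarith

/-! ### Supermartingales against a delayed adversary -/

lemma past_congr {n : ℕ} {x x' : Fin n → Bool} {t : Fin n} (h : ∀ s < t, x s = x' s) :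
    past x t = past x' t := by
  funext s
  exact h _ s.2

/-- The joint probability of the input `x` and the state `z` when bit `t` is an independent coin of
law `q t` and the adversary draws its state from `G t` given the past. -/
def pathWeight {n : ℕ} (q : Fin n → Bool → ℝ)
    (G : (t : Fin n) → (Fin (t : ℕ) → Bool) → Bool → ℝ) (x z : Fin n → Bool) : ℝ :=
  ∏ t, q t (x t) * G t (past x t) (z t)

/-- Let `Φ k` be a potential of the first `k` inputs and states that an erasure does not increase,
and that does not increase on average over the bit sent, if that bit is kept. Then its final
expectation is at most its initial value. One bit of delay enters here: given the past, the state
at `t` is independent of the bit at `t`. -/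
theorem sum_pathWeight_mul_le {n : ℕ} {q : Fin n → Bool → ℝ}
    {G : (t : Fin n) → (Fin (t : ℕ) → Bool) → Bool → ℝ}
    (hq0 : ∀ t b, 0 ≤ q t b) (hq1 : ∀ t, ∑ b, q t b = 1)
    (hG0 : ∀ t h b, 0 ≤ G t h b) (hG1 : ∀ t h, ∑ b, G t h b = 1)
    (Φ : ℕ → (Fin n → Bool) → (Fin n → Bool) → ℝ) {K : ℝ} (h0 : ∀ x z, Φ 0 x z ≤ K)
    (herase : ∀ (t : Fin n) x z b,
      Φ (t + 1) (Function.update x t b) (Function.update z t true) ≤ Φ t x z)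
    (hkeep : ∀ (t : Fin n) x z,
      ∑ b, q t b * Φ (t + 1) (Function.update x t b) (Function.update z t false) ≤ Φ t x z) :
    ∑ x, ∑ z, pathWeight q G x z * Φ n x z ≤ K := by
  let a : Fin n → (Fin n → Bool) → (Fin n → Bool) → ℝ := fun t x z =>
    q t (x t) * G t (past x t) (z t)
  have ha : ∀ t x z, 0 ≤ a t x z := fun t x z => mul_nonneg (hq0 _ _) (hG0 _ _ _)
  -- `g k` also sums over the coordinates from `k` on, which do not matter, so that the
  -- expectation at time `k` is multiplied by `4 ^ (n - k)`.
  let g : ℕ → (Fin n → Bool) → (Fin n → Bool) → ℝ := fun k x z =>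
    (∏ t ∈ Finset.univ.filter (fun t : Fin n => (t : ℕ) < k), a t x z) * Φ k x z
  have hstep : ∀ t : Fin n, 4 * ∑ x, ∑ z, g (t + 1) x z ≤ ∑ x, ∑ z, g t x z := by
    intro t
    have hexp : 4 * ∑ x, ∑ z, g (t + 1) x z = ∑ x, ∑ z, ∑ b, ∑ c,
        g (t + 1) (Function.update x t b) (Function.update z t c) := by
      have h1 := card_mul_sum_eq_sum_update t fun x => ∑ z, g (t + 1) x z
      have h2 : ∀ x, _ := fun x => card_mul_sum_eq_sum_update t fun z => g (t + 1) x z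
      simp only [Fintype.card_bool, Nat.cast_ofNat] at h1 h2
      calc 4 * ∑ x, ∑ z, g (t + 1) x z = 2 * (2 * ∑ x, ∑ z, g (t + 1) x z) := by ring
        _ = ∑ x, ∑ b, 2 * ∑ z, g (t + 1) (Function.update x t b) z := by
            rw [h1]; simp_rw [Finset.mul_sum]
        _ = ∑ x, ∑ b, ∑ z, ∑ c, g (t + 1) (Function.update x t b) (Function.update z t c) := by
            simp_rw [h2]
        _ = _ := Finset.sum_congr rfl fun x _ => Finset.sum_comm
    rw [hexp]
    refine Finset.sum_le_sum fun x _ => Finset.sum_le_sum fun z _ => ?_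
    have hfilter : Finset.univ.filter (fun s : Fin n => (s : ℕ) < t + 1) =
        insert t (Finset.univ.filter fun s : Fin n => (s : ℕ) < t) := by
      ext s
      simp only [Finset.mem_filter, Finset.mem_univ, true_and, Finset.mem_insert, Fin.ext_iff]
      omega
    have hg : ∀ b c, g (t + 1) (Function.update x t b) (Function.update z t c) =
        (∏ s ∈ Finset.univ.filter (fun s : Fin n => (s : ℕ) < t), a s x z) *
        (q t b * G t (past x t) c *
          Φ (t + 1) (Function.update x t b) (Function.update z t c)) := by
      intro b c
      simp only [g]
      rw [hfilter, Finset.prod_insert (by simp)]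
      have hprod : ∏ s ∈ Finset.univ.filter (fun s : Fin n => (s : ℕ) < t),
          a s (Function.update x t b) (Function.update z t c) =
          ∏ s ∈ Finset.univ.filter (fun s : Fin n => (s : ℕ) < t), a s x z := by
        refine Finset.prod_congr rfl fun s hs => ?_
        have hst : s < t := (Finset.mem_filter.1 hs).2
        have hpast : past (Function.update x t b) s = past x s :=
          past_congr fun r hr => Function.update_of_ne (hr.trans hst).ne _ _
        simp only [a, hpast, Function.update_of_ne hst.ne]
      have hpast : past (Function.update x t b) t = past x t :=
        past_congr fun r hr => Function.update_of_ne hr.ne _ _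
      rw [hprod]
      simp only [a, hpast, Function.update_self]
      ring
    simp_rw [hg, ← Finset.mul_sum]
    refine mul_le_mul_of_nonneg_left ?_ (Finset.prod_nonneg fun s _ => ha s x z)
    have hk := hkeep t x z
    have he := herase t x z
    have hqt := hq1 t
    have hGt := hG1 t (past x t)
    simp only [Fintype.sum_bool] at hk hqt hGt ⊢
    have he1 := mul_le_mul_of_nonneg_left (he true) (hq0 t true)
    have he2 := mul_le_mul_of_nonneg_left (he false) (hq0 t false)
    have h1 := mul_le_mul_of_nonneg_left (add_le_add he1 he2) (hG0 t (past x t) true)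
    have h2 := mul_le_mul_of_nonneg_left hk (hG0 t (past x t) false)
    have h3 : G t (past x t) true * (q t true * Φ t x z + q t false * Φ t x z) +
        G t (past x t) false * Φ t x z = Φ t x z := by
      rw [← add_mul, hqt, one_mul, ← add_mul, hGt, one_mul]
    linarith
  have hind : ∀ k ≤ n, 4 ^ k * ∑ x, ∑ z, g k x z ≤ ∑ x, ∑ z, g 0 x z := by
    intro k
    induction k with
    | zero => intro _; simp
    | succ k ih =>
      intro hk
      have h1 := hstep ⟨k, hk⟩
      have h2 := ih (by omega)
      have h3 := mul_le_mul_of_nonneg_left h1 (by positivity : (0 : ℝ) ≤ 4 ^ k)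
      simp only at h3
      calc _ = 4 ^ k * (4 * ∑ x, ∑ z, g (k + 1) x z) := by ring
        _ ≤ _ := h3.trans h2
  have hfin := hind n le_rfl
  have hzero : ∑ x, ∑ z, g 0 x z ≤ 4 ^ n * K := by
    calc ∑ x, ∑ z, g 0 x z ≤ ∑ _x : Fin n → Bool, ∑ _z : Fin n → Bool, K := by
          refine Finset.sum_le_sum fun x _ => Finset.sum_le_sum fun z _ => ?_
          simpa [g] using h0 x z
      _ = 4 ^ n * K := by
          have : (4 : ℝ) = 2 * 2 := by norm_num
          simp only [Finset.sum_const, Finset.card_univ, Fintype.card_fun, Fintype.card_bool,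
            Fintype.card_fin, nsmul_eq_mul, this, mul_pow]
          push_cast
          ring
  have hn : ∑ x, ∑ z, g n x z = ∑ x, ∑ z, pathWeight q G x z * Φ n x z := by
    simp [g, a, pathWeight]
  rw [← hn]
  exact le_of_mul_le_mul_left (hfin.trans hzero) (by positivity)

/-! ### Head and tail of the unerased positions -/

/-- The unerased positions before time `k`. -/
def kept {n : ℕ} (z : Fin n → Bool) (k : ℕ) : Finset (Fin n) :=
  Finset.univ.filter fun s => (s : ℕ) < k ∧ z s = false

/-- The first `N` unerased positions, as far as they come before time `k`. -/
def head {n : ℕ} (N : ℕ) (z : Fin n → Bool) (k : ℕ) : Finset (Fin n) :=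
  (kept z k).filter fun s => (kept z s).card < N

/-- The unerased positions after the first `N` of them, before time `k`. -/
def tail {n : ℕ} (N : ℕ) (z : Fin n → Bool) (k : ℕ) : Finset (Fin n) :=
  (kept z k).filter fun s => N ≤ (kept z s).card

section Sets
variable {n N : ℕ} {z : Fin n → Bool} {t : Fin n}

lemma mem_kept {k : ℕ} {s : Fin n} : s ∈ kept z k ↔ (s : ℕ) < k ∧ z s = false := by
  simp [kept]

@[simp] lemma kept_zero : kept z 0 = ∅ := by simp [kept]
@[simp] lemma head_zero : head N z 0 = ∅ := by simp [head]

lemma kept_update {k : ℕ} (hk : k ≤ t) (c : Bool) : kept (Function.update z t c) k = kept z k := by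
  ext s
  simp only [mem_kept]
  refine and_congr_right fun hs => ?_
  rw [Function.update_of_ne (Fin.ne_of_val_ne (by omega))]

lemma kept_succ_update_true : kept (Function.update z t true) (t + 1) = kept z t := by
  ext s
  simp only [mem_kept]
  rcases eq_or_ne s t with rfl | h
  · simp
  · rw [Function.update_of_ne h]
    have : (s : ℕ) ≠ t := fun h' => h (Fin.ext h')
    refine and_congr_left fun _ => ?_
    omega

lemma kept_succ_update_false :
    kept (Function.update z t false) (t + 1) = insert t (kept z t) := by
  ext s
  simp only [mem_kept, Finset.mem_insert]
  rcases eq_or_ne s t with rfl | h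
  · simp
  · rw [Function.update_of_ne h]
    have : (s : ℕ) ≠ t := fun h' => h (Fin.ext h')
    simp only [h, false_or]
    refine and_congr_left fun _ => ?_
    omega

lemma self_notMem_kept : t ∉ kept z t := by simp [mem_kept]

lemma filter_kept_update (P : ℕ → Prop) [DecidablePred P] (c : Bool) :
    (kept z t).filter (fun s : Fin n => P (kept (Function.update z t c) s).card) =
      (kept z t).filter fun s : Fin n => P (kept z s).card := by
  refine Finset.filter_congr fun s hs => ?_
  rw [kept_update (mem_kept.1 hs).1.le]

lemma head_succ_update_true : head N (Function.update z t true) (t + 1) = head N z t := by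
  rw [head, head, kept_succ_update_true, filter_kept_update (fun i => i < N)]

lemma tail_succ_update_true : tail N (Function.update z t true) (t + 1) = tail N z t := by
  rw [tail, tail, kept_succ_update_true, filter_kept_update (fun i => N ≤ i)]

lemma head_succ_update_false : head N (Function.update z t false) (t + 1) =
    if (kept z t).card < N then insert t (head N z t) else head N z t := by
  rw [head, head, kept_succ_update_false, Finset.filter_insert, kept_update le_rfl,
    filter_kept_update (fun i => i < N)]

lemma tail_succ_update_false : tail N (Function.update z t false) (t + 1) =
    if N ≤ (kept z t).card then insert t (tail N z t) else tail N z t := by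
  rw [tail, tail, kept_succ_update_false, Finset.filter_insert, kept_update le_rfl,
    filter_kept_update (fun i => N ≤ i)]

lemma self_notMem_head : t ∉ head N z t := fun h => self_notMem_kept (Finset.mem_filter.1 h).1

lemma self_notMem_tail : t ∉ tail N z t := fun h => self_notMem_kept (Finset.mem_filter.1 h).1

lemma card_head (N : ℕ) (z : Fin n → Bool) {k : ℕ} (hk : k ≤ n) :
    (head N z k).card = min N (kept z k).card := by
  induction k with
  | zero => simp
  | succ k ih =>
    specialize ih (by omega)
    obtain ⟨t, rfl⟩ : ∃ t : Fin n, (t : ℕ) = k := ⟨⟨k, hk⟩, rfl⟩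
    rcases hz : z t with _ | _
    · have h := head_succ_update_false (N := N) (z := z) (t := t)
      have h' := kept_succ_update_false (z := z) (t := t)
      rw [← hz, Function.update_eq_self] at h h'
      rw [h, h', Finset.card_insert_of_notMem self_notMem_kept]
      split_ifs with hlt
      · rw [Finset.card_insert_of_notMem self_notMem_head, ih]
        omega
      · rw [ih]
        omega
    · have h := head_succ_update_true (N := N) (z := z) (t := t)
      have h' := kept_succ_update_true (z := z) (t := t)
      rw [← hz, Function.update_eq_self] at h h'
      rw [h, h', ih]

lemma card_kept_mono {j k : ℕ} (h : j ≤ k) : (kept z j).card ≤ (kept z k).card :=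
  Finset.card_le_card fun _ hs =>
    mem_kept.2 ⟨(mem_kept.1 hs).1.trans_le h, (mem_kept.1 hs).2⟩

lemma tail_eq_empty_of_card_lt {k : ℕ} (h : (kept z k).card < N) : tail N z k = ∅ :=
  Finset.filter_eq_empty_iff.2 fun _ hs =>
    ((card_kept_mono (mem_kept.1 hs).1.le).trans_lt h).not_ge

lemma card_head_add_card_tail (k : ℕ) :
    (head N z k).card + (tail N z k).card = (kept z k).card := by
  unfold head tail
  simp_rw [← not_lt]
  exact Finset.card_filter_add_card_filter_not _

lemma card_kept_add_cost (z : Fin n → Bool) : (kept z n).card + cost z = n := by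
  have h := Finset.card_filter_add_card_filter_not (s := (Finset.univ : Finset (Fin n)))
    fun t => z t = true
  simp only [Finset.card_univ, Fintype.card_fin, Bool.not_eq_true] at h
  have hk : kept z n = Finset.univ.filter fun t => z t = false := by
    ext s; simp [mem_kept]
  rw [hk, cost]
  omega

end Sets

/-! ### The decoder -/

/-- Message `m` is plausible if its likelihood on the first `N` unerased positions is at least
`2 ^ (-d)`. -/
def Plausible {n M : ℕ} {A : Type*} (q : A → Bool → ℝ) (c : Fin n → Fin M → A) (N d : ℕ)
    (x z : Fin n → Bool) (m : Fin M) : Prop :=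
  (1 / 2 : ℝ) ^ d ≤ lik q (fun t => c t m) (head N z n) x

/-- Message `m` wins if it is plausible and strictly more likely, on the tail of the unerased
positions, than all other plausible messages. -/
def Wins {n M : ℕ} {A : Type*} (q : A → Bool → ℝ) (c : Fin n → Fin M → A) (N d : ℕ)
    (x z : Fin n → Bool) (m : Fin M) : Prop :=
  Plausible q c N d x z m ∧ ∀ m' ≠ m, Plausible q c N d x z m' →
    lik q (fun t => c t m') (tail N z n) x < lik q (fun t => c t m) (tail N z n) x

open Classical in
/-- The decoder returns the winning message, if there is one. The bit `false` that it puts at the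
erased positions is never looked at. -/
def decode {n M : ℕ} {A : Type*} (q : A → Bool → ℝ) (c : Fin n → Fin M → A) (N d : ℕ)
    (y : Fin n → Option Bool) : Option (Fin M) :=
  if h : ∃ m, Wins q c N d (fun t => (y t).getD false) (fun t => (y t).isNone) m
  then some h.choose else none

section Decoder
variable {n M N d : ℕ} {A : Type*} {q : A → Bool → ℝ} {c : Fin n → Fin M → A}
  {x x' z : Fin n → Bool} {m m' : Fin M}

lemma Wins.unique (h : Wins q c N d x z m) (h' : Wins q c N d x z m') : m = m' := by
  by_contra hne
  exact lt_asymm (h.2 m' (Ne.symm hne) h'.1) (h'.2 m hne h.1)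

lemma lik_congr {a : Fin n → A} {U : Finset (Fin n)} (h : ∀ t ∈ U, x t = x' t) :
    lik q a U x = lik q a U x' :=
  Finset.prod_congr rfl fun t ht => by rw [h t ht]

lemma decode_output (h : Wins q c N d x z m) : decode q c N d (output x z) = some m := by
  have hz : (fun t => (output x z t).isNone) = z := by
    funext t
    cases ht : z t <;> simp [output, ht]
  have hx : ∀ t ∈ kept z n, (output x z t).getD false = x t := by
    intro t ht
    simp [output, (mem_kept.1 ht).2]
  have hhead : ∀ m, lik q (fun t => c t m) (head N z n) (fun t => (output x z t).getD false) =
      lik q (fun t => c t m) (head N z n) x := fun m =>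
    lik_congr fun t ht => hx t (Finset.mem_filter.1 ht).1
  have htail : ∀ m, lik q (fun t => c t m) (tail N z n) (fun t => (output x z t).getD false) =
      lik q (fun t => c t m) (tail N z n) x := fun m =>
    lik_congr fun t ht => hx t (Finset.mem_filter.1 ht).1
  have hwins : ∀ m, Wins q c N d (fun t => (output x z t).getD false)
      (fun t => (output x z t).isNone) m ↔ Wins q c N d x z m := by
    intro m
    rw [hz]
    simp only [Wins, Plausible, hhead, htail]
  have hex : ∃ m, Wins q c N d (fun t => (output x z t).getD false)
      (fun t => (output x z t).isNone) m := ⟨m, (hwins m).2 h⟩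
  rw [decode, dif_pos hex]
  exact congrArg some (((hwins _).1 hex.choose_spec).unique h)

end Decoder

/-! ### Error analysis -/

section Error
variable {n M : ℕ} {A : Type*} {q : A → Bool → ℝ}
  {G : (t : Fin n) → (Fin (t : ℕ) → Bool) → Bool → ℝ}

lemma prod_update_of_notMem {f : Fin n → Bool → ℝ} {U : Finset (Fin n)} {t : Fin n} (ht : t ∉ U)
    (x : Fin n → Bool) (b : Bool) :
    ∏ s ∈ U, f s (Function.update x t b s) = ∏ s ∈ U, f s (x s) :=
  Finset.prod_congr rfl fun s hs => by
    rw [Function.update_of_ne (ne_of_mem_of_not_mem hs ht)]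

open Classical in
/-- The transmitted message is rarely implausible: `∏ q ^ (-1/2)` over the head grows by a factor of
at most `∑ b, √(q b) ≤ σ` per position on average. -/
theorem sum_implausible_le (hq : ∀ a b, 0 < q a b) (hq1 : ∀ a, ∑ b, q a b = 1)
    (hG0 : ∀ t h b, 0 ≤ G t h b) (hG1 : ∀ t h, ∑ b, G t h b = 1)
    {σ : ℝ} (hσ1 : 1 ≤ σ) (hσ : ∀ a, ∑ b, √(q a b) ≤ σ)
    (c : Fin n → Fin M → A) (N d : ℕ) (m : Fin M) :
    ∑ x, ∑ z, pathWeight (fun t => q (c t m)) G x z *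
      (if Plausible q c N d x z m then 0 else 1) ≤ σ ^ n * √(1 / 2) ^ d := by
  let f : Fin n → Bool → ℝ := fun s b => (√(q (c s m) b))⁻¹ / σ
  have hσ0 : 0 < σ := by linarith
  have hf : ∀ s b, 0 < f s b := fun s b =>
    div_pos (inv_pos.2 (Real.sqrt_pos.2 (hq _ _))) hσ0
  have hmart := sum_pathWeight_mul_le (q := fun t => q (c t m)) (G := G)
    (fun t b => (hq _ b).le) (fun t => hq1 _) hG0 hG1
    (fun k x z => ∏ s ∈ head N z k, f s (x s)) (K := 1) (by simp)
    (by
      intro t x z b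
      rw [head_succ_update_true, prod_update_of_notMem self_notMem_head])
    (by
      intro t x z
      rw [head_succ_update_false]
      split_ifs
      · have : ∀ b, q (c t m) b * ∏ s ∈ insert t (head N z t), f s (Function.update x t b s) =
            (∏ s ∈ head N z t, f s (x s)) * (√(q (c t m) b) / σ) := by
          intro b
          rw [Finset.prod_insert self_notMem_head, prod_update_of_notMem self_notMem_head]
          simp only [Function.update_self, f]
          have h0 : √(q (c t m) b) ≠ 0 := (Real.sqrt_pos.2 (hq _ _)).ne'
          nth_rewrite 1 [← Real.mul_self_sqrt (hq (c t m) b).le]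
          field_simp
        simp_rw [this, ← Finset.mul_sum, ← Finset.sum_div]
        exact mul_le_of_le_one_right (Finset.prod_nonneg fun s _ => (hf _ _).le)
          ((div_le_one hσ0).2 (hσ _))
      · simp_rw [prod_update_of_notMem self_notMem_head, ← Finset.sum_mul]
        rw [hq1, one_mul])
  have hpt : ∀ x z, (if Plausible q c N d x z m then (0 : ℝ) else 1) ≤
      σ ^ n * √(1 / 2) ^ d * ∏ s ∈ head N z n, f s (x s) := by
    intro x z
    have hprod : 0 < ∏ s ∈ head N z n, f s (x s) := Finset.prod_pos fun s _ => hf _ _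
    split_ifs with h
    · positivity
    · unfold Plausible at h
      rw [not_le] at h
      have hlik : 0 < lik q (fun t => c t m) (head N z n) x := Finset.prod_pos fun t _ => hq _ _
      have h1 : √(lik q (fun t => c t m) (head N z n) x) =
          ∏ s ∈ head N z n, √(q (c s m) (x s)) :=
        Real.sqrt_prod _ fun t _ => (hq _ _).le
      have h2 : ∏ s ∈ head N z n, f s (x s) =
          (√(lik q (fun t => c t m) (head N z n) x))⁻¹ / σ ^ (head N z n).card := by
        simp only [f]
        rw [Finset.prod_div_distrib, Finset.prod_const, Finset.prod_inv_distrib, h1]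
      have h3 : σ ^ (head N z n).card ≤ σ ^ n :=
        pow_le_pow_right₀ hσ1 ((Finset.card_le_univ _).trans_eq (by simp))
      have h4 : √(lik q (fun t => c t m) (head N z n) x) ≤ √(1 / 2) ^ d := by
        rw [Real.sqrt_le_iff]
        refine ⟨by positivity, ?_⟩
        rw [← pow_mul, mul_comm d, pow_mul, Real.sq_sqrt (by norm_num)]
        exact h.le
      have h5 := Real.sqrt_pos.2 hlik
      have h6 : 0 < σ ^ (head N z n).card := by positivity
      rw [h2, inv_eq_one_div, div_div, mul_one_div, one_le_div (by positivity), mul_comm]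
      exact mul_le_mul h3 h4 h5.le (by positivity)
  calc _ ≤ ∑ x, ∑ z, σ ^ n * √(1 / 2) ^ d * (pathWeight (fun t => q (c t m)) G x z *
        ∏ s ∈ head N z n, f s (x s)) := by
        refine Finset.sum_le_sum fun x _ => Finset.sum_le_sum fun z _ => ?_
        have hw : 0 ≤ pathWeight (fun t => q (c t m)) G x z :=
          Finset.prod_nonneg fun t _ => mul_nonneg (hq _ _).le (hG0 _ _ _)
        calc _ ≤ _ := mul_le_mul_of_nonneg_left (hpt x z) hw
          _ = _ := by ring
    _ = σ ^ n * √(1 / 2) ^ d * ∑ x, ∑ z, (pathWeight (fun t => q (c t m)) G x z *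
        ∏ s ∈ head N z n, f s (x s)) := by simp_rw [Finset.mul_sum]
    _ ≤ σ ^ n * √(1 / 2) ^ d * 1 := by gcongr
    _ = _ := mul_one _

open Classical in
/-- Let `n - cost z ≥ N + 2 * d`, let different messages agree in at most `d` positions, and let
each choice of the head leave at most `ℓ` plausible messages. Then it is unlikely that a plausible
rival beats the transmitted message on the tail: from the end of the head on, the square roots of
the likelihood ratios of the at most `ℓ` rivals shrink on average by `ρ` at each position where the
rival's coin differs, and this happens at least `d` times. -/
theorem sum_rival_le (hq : ∀ a b, 0 < q a b) (hq1 : ∀ a, ∑ b, q a b = 1)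
    (hG0 : ∀ t h b, 0 ≤ G t h b) (hG1 : ∀ t h, ∑ b, G t h b = 1)
    {ρ : ℝ} (hρ0 : 0 < ρ) (hρ1 : ρ ≤ 1)
    (hρ : ∀ a a', a ≠ a' → ∑ b, √(q a b) * √(q a' b) ≤ ρ)
    (c : Fin n → Fin M → A) {N d ℓ : ℕ} (hN : 0 < N)
    (hagree : ∀ m m', m ≠ m' → (Finset.univ.filter fun t => c t m = c t m').card ≤ d)
    (hlist : ∀ U : Finset (Fin n), U.card = N → ∀ x : Fin n → Bool,
      (Finset.univ.filter fun m => (1 / 2 : ℝ) ^ d ≤ lik q (fun t => c t m) U x).card ≤ ℓ)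
    (m : Fin M) :
    ∑ x, ∑ z, pathWeight (fun t => q (c t m)) G x z *
      (if N + 2 * d + cost z ≤ n ∧ ∃ m' ≠ m, Plausible q c N d x z m' ∧
        lik q (fun t => c t m) (tail N z n) x ≤ lik q (fun t => c t m') (tail N z n) x
        then 1 else 0) ≤ ℓ * ρ ^ d := by
  let r : Fin M → Fin n → ℝ := fun m' s => if c s m = c s m' then 1 else ρ
  let f : Fin M → Fin n → Bool → ℝ := fun m' s b =>
    √(q (c s m') b) / √(q (c s m) b) / r m' s
  have hr : ∀ m' s, 0 < r m' s := by
    intro m' s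
    simp only [r]
    split_ifs <;> linarith
  have hf : ∀ m' s b, 0 < f m' s b := fun m' s b =>
    div_pos (div_pos (Real.sqrt_pos.2 (hq _ _)) (Real.sqrt_pos.2 (hq _ _))) (hr _ _)
  have hfsum : ∀ m' s, ∑ b, q (c s m) b * f m' s b ≤ 1 := by
    intro m' s
    have : ∀ b, q (c s m) b * f m' s b = √(q (c s m) b) * √(q (c s m') b) / r m' s := by
      intro b
      simp only [f]
      have h0 : √(q (c s m) b) ≠ 0 := (Real.sqrt_pos.2 (hq _ _)).ne'
      nth_rewrite 1 [← Real.mul_self_sqrt (hq (c s m) b).le]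
      field_simp
    simp_rw [this, ← Finset.sum_div]
    rw [div_le_one (hr _ _)]
    by_cases h : c s m = c s m'
    · simp only [r, h, if_true]
      simp_rw [Real.mul_self_sqrt (hq _ _).le, hq1, le_refl]
    · simp only [r, h, if_false]
      exact hρ _ _ h
  let Ψ : ℕ → (Fin n → Bool) → (Fin n → Bool) → ℝ := fun k x z =>
    ∑ m' ∈ Finset.univ.erase m,
      if (1 / 2 : ℝ) ^ d ≤ lik q (fun t => c t m') (head N z k) x
      then ∏ s ∈ tail N z k, f m' s (x s) else 0
  let Φ : ℕ → (Fin n → Bool) → (Fin n → Bool) → ℝ := fun k x z =>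
    if (kept z k).card < N then (ℓ : ℝ) else Ψ k x z
  have hlikup : ∀ (t : Fin n) m' x z b,
      lik q (fun t => c t m') (head N z t) (Function.update x t b) =
      lik q (fun t => c t m') (head N z t) x := fun t m' x z b =>
    prod_update_of_notMem (f := fun s b => q (c s m') b) self_notMem_head x b
  have hmart := sum_pathWeight_mul_le (q := fun t => q (c t m)) (G := G)
    (fun t b => (hq _ b).le) (fun t => hq1 _) hG0 hG1 Φ (K := ℓ) (by simp [Φ, hN])
    (by
      intro t x z b
      simp only [Φ, Ψ]
      rw [kept_succ_update_true, head_succ_update_true, tail_succ_update_true]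
      simp_rw [hlikup, prod_update_of_notMem (self_notMem_tail (N := N) (z := z) (t := t))]
      exact le_rfl)
    (by
      intro t x z
      by_cases hlt : (kept z t).card < N
      · have hle : ∀ b, Φ (t + 1) (Function.update x t b) (Function.update z t false) ≤ ℓ := by
          intro b
          simp only [Φ, Ψ]
          split_ifs with hlt'
          · exact le_rfl
          · have hcard : (kept (Function.update z t false) (t + 1)).card =
                (kept z t).card + 1 := by
              rw [kept_succ_update_false, Finset.card_insert_of_notMem self_notMem_kept]
            have htail : tail N (Function.update z t false) (t + 1) = ∅ := by
              rw [tail_succ_update_false, if_neg (not_le.2 hlt), tail_eq_empty_of_card_lt hlt]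
            have hhead : (head N (Function.update z t false) (t + 1)).card = N := by
              rw [card_head _ _ (k := (t : ℕ) + 1) t.isLt]
              omega
            rw [htail]
            simp only [Finset.prod_empty]
            rw [Finset.sum_boole]
            exact_mod_cast (Finset.card_le_card
              (Finset.filter_subset_filter _ (Finset.erase_subset _ _))).trans
              (hlist _ hhead _)
        have hΦ : Φ t x z = ℓ := if_pos hlt
        rw [hΦ]
        calc _ ≤ ∑ b, q (c t m) b * ℓ :=
              Finset.sum_le_sum fun b _ => mul_le_mul_of_nonneg_left (hle b) (hq _ _).le
          _ = ℓ := by rw [← Finset.sum_mul, hq1, one_mul]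
      · have hcard : ¬ (kept (Function.update z t false) (t + 1)).card < N := by
          rw [kept_succ_update_false, Finset.card_insert_of_notMem self_notMem_kept]
          omega
        simp only [Φ, if_neg hcard, if_neg hlt, Ψ]
        rw [head_succ_update_false, if_neg hlt, tail_succ_update_false, if_pos (not_lt.1 hlt)]
        simp_rw [hlikup, Finset.prod_insert (self_notMem_tail (N := N) (z := z) (t := t)),
          prod_update_of_notMem (self_notMem_tail (N := N) (z := z) (t := t)),
          Function.update_self, Finset.mul_sum]
        rw [Finset.sum_comm]
        refine Finset.sum_le_sum fun m' _ => ?_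
        split_ifs
        · simp_rw [← mul_assoc, ← Finset.sum_mul]
          exact mul_le_of_le_one_left (Finset.prod_nonneg fun s _ => (hf _ _ _).le) (hfsum m' t)
        · simp)
  have hΨ0 : ∀ k x z, 0 ≤ Ψ k x z := by
    intro k x z
    refine Finset.sum_nonneg fun m' _ => ?_
    split_ifs
    · exact Finset.prod_nonneg fun s _ => (hf _ _ _).le
    · exact le_rfl
  have hΦ0 : ∀ k x z, 0 ≤ Φ k x z := by
    intro k x z
    simp only [Φ]
    split_ifs
    · positivity
    · exact hΨ0 _ _ _
  have hpt : ∀ x z, (if N + 2 * d + cost z ≤ n ∧ ∃ m' ≠ m, Plausible q c N d x z m' ∧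
        lik q (fun t => c t m) (tail N z n) x ≤ lik q (fun t => c t m') (tail N z n) x
        then (1 : ℝ) else 0) ≤ ρ ^ d * Φ n x z := by
    intro x z
    split_ifs with h
    · obtain ⟨hcost, m', hm', hpl, hle⟩ := h
      have hkept := card_kept_add_cost z
      have hnot : ¬ (kept z n).card < N := by omega
      have hhead := card_head N z le_rfl
      have hsum := card_head_add_card_tail (N := N) (z := z) n
      have hdiff : d ≤ ((tail N z n).filter fun s => ¬ c s m = c s m').card := by
        have h1 := Finset.card_filter_add_card_filter_not (s := tail N z n)
          fun s => c s m = c s m'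
        have h2 : ((tail N z n).filter fun s => c s m = c s m').card ≤ d :=
          (Finset.card_le_card (Finset.filter_subset_filter _ (Finset.subset_univ _))).trans
            (hagree m m' hm'.symm)
        omega
      have hrprod : ∏ s ∈ tail N z n, r m' s ≤ ρ ^ d := by
        simp only [r]
        rw [Finset.prod_ite, Finset.prod_const_one, one_mul, Finset.prod_const]
        exact pow_le_pow_of_le_one hρ0.le hρ1 hdiff
      have hlik : 0 < lik q (fun t => c t m) (tail N z n) x := Finset.prod_pos fun t _ => hq _ _
      have hratio : 1 ≤ (∏ s ∈ tail N z n, f m' s (x s)) * ∏ s ∈ tail N z n, r m' s := by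
        rw [← Finset.prod_mul_distrib]
        have : ∀ s ∈ tail N z n, f m' s (x s) * r m' s =
            √(q (c s m') (x s)) / √(q (c s m) (x s)) := fun s _ =>
          div_mul_cancel₀ _ (hr m' s).ne'
        rw [Finset.prod_congr rfl this, Finset.prod_div_distrib,
          ← Real.sqrt_prod _ fun t _ => (hq _ _).le, ← Real.sqrt_prod _ fun t _ => (hq _ _).le]
        exact (one_le_div (Real.sqrt_pos.2 hlik)).2 (Real.sqrt_le_sqrt hle)
      have hterm : ∏ s ∈ tail N z n, f m' s (x s) ≤ Ψ n x z := by
        have := Finset.single_le_sum (s := Finset.univ.erase m) (f := fun m' =>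
          if (1 / 2 : ℝ) ^ d ≤ lik q (fun t => c t m') (head N z n) x
          then ∏ s ∈ tail N z n, f m' s (x s) else 0) (fun m' _ => by
            split_ifs
            · exact Finset.prod_nonneg fun s _ => (hf _ _ _).le
            · exact le_rfl) (Finset.mem_erase.2 ⟨hm', Finset.mem_univ m'⟩)
        unfold Plausible at hpl
        rwa [if_pos hpl] at this
      have hΦ : Φ n x z = Ψ n x z := if_neg hnot
      rw [hΦ, mul_comm]
      exact hratio.trans (mul_le_mul hterm hrprod
        (Finset.prod_nonneg fun s _ => (hr _ _).le) (hΨ0 _ _ _))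
    · exact mul_nonneg (by positivity) (hΦ0 _ _ _)
  calc _ ≤ ∑ x, ∑ z, ρ ^ d * (pathWeight (fun t => q (c t m)) G x z * Φ n x z) := by
        refine Finset.sum_le_sum fun x _ => Finset.sum_le_sum fun z _ => ?_
        have hw : 0 ≤ pathWeight (fun t => q (c t m)) G x z :=
          Finset.prod_nonneg fun t _ => mul_nonneg (hq _ _).le (hG0 _ _ _)
        calc _ ≤ _ := mul_le_mul_of_nonneg_left (hpt x z) hw
          _ = _ := by ring
    _ = ρ ^ d * ∑ x, ∑ z, (pathWeight (fun t => q (c t m)) G x z * Φ n x z) := by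
        simp_rw [Finset.mul_sum]
    _ ≤ ρ ^ d * ℓ := by gcongr
    _ = _ := mul_comm _ _

end Error

/-! ### Codes made of biased coins -/

/-- The law of a word of independent bits, the `t`-th one a coin of law `q (a t)`. -/
def coinWord {n : ℕ} {A : Type*} (q : A → Bool → ℝ) (hq : ∀ a b, 0 < q a b)
    (hq1 : ∀ a, ∑ b, q a b = 1) (a : Fin n → A) : PMF (Fin n → Bool) :=
  PMF.ofFintype (fun x => ENNReal.ofReal (∏ t, q (a t) (x t))) <| by
    rw [← ENNReal.ofReal_sum_of_nonneg fun x _ => Finset.prod_nonneg fun t _ => (hq _ _).le]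
    rw [← Fintype.prod_sum fun (t : Fin n) (b : Bool) => q (a t) b]
    simp only [hq1, Finset.prod_const_one, ENNReal.ofReal_one]

/-- The code that encodes a message into coins, with its decoder. -/
def coinCode {n M : ℕ} {A : Type*} (q : A → Bool → ℝ) (hq : ∀ a b, 0 < q a b)
    (hq1 : ∀ a, ∑ b, q a b = 1) (c : Fin n → Fin M → A) (N d : ℕ) : StochasticCode n M where
  enc m := coinWord q hq hq1 fun t => c t m
  dec := decode q c N d

/-- The error bound for one blocklength. The hypothesis `hp` says that at least `N + 2 * d` positions
stay unerased, of which at least `d` in the tail tell any two messages apart. -/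
theorem maxErrorProb_coinCode_le {n M : ℕ} {A : Type*} {q : A → Bool → ℝ}
    (hq : ∀ a b, 0 < q a b) (hq1 : ∀ a, ∑ b, q a b = 1)
    {σ ρ : ℝ} (hσ1 : 1 ≤ σ) (hσ : ∀ a, ∑ b, √(q a b) ≤ σ) (hρ0 : 0 < ρ) (hρ1 : ρ ≤ 1)
    (hρ : ∀ a a', a ≠ a' → ∑ b, √(q a b) * √(q a' b) ≤ ρ)
    (c : Fin n → Fin M → A) {N d ℓ : ℕ} (hN : 0 < N) [DecidableEq A]
    (hagree : ∀ m m', m ≠ m' → (Finset.univ.filter fun t => c t m = c t m').card ≤ d)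
    (hlist : ∀ U : Finset (Fin n), U.card = N → ∀ x : Fin n → Bool,
      (Finset.univ.filter fun m => (1 / 2 : ℝ) ^ d ≤ lik q (fun t => c t m) U x).card ≤ ℓ)
    {p : ℝ} (hp : (N : ℝ) + 2 * d ≤ (1 - p) * n) :
    maxErrorProb p (coinCode q hq hq1 c N d) ≤
      ENNReal.ofReal (σ ^ n * √(1 / 2) ^ d + ℓ * ρ ^ d) := by
  classical
  refine iSup_le fun Γ => iSup_le fun hΓ => iSup_le fun m => ?_
  let G : (t : Fin n) → (Fin (t : ℕ) → Bool) → Bool → ℝ := fun t h b => (Γ t h b).toReal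
  have hG0 : ∀ t h b, 0 ≤ G t h b := fun t h b => ENNReal.toReal_nonneg
  have hG1 : ∀ t h, ∑ b, G t h b = 1 := by
    intro t h
    simp only [G]
    have hsum : ∑ b, Γ t h b = 1 := by
      rw [← (Γ t h).tsum_coe, tsum_fintype]
    rw [← ENNReal.toReal_sum fun b _ => (Γ t h).apply_ne_top b, hsum, ENNReal.toReal_one]
  have hstate : ∀ x z, stateProb Γ x z = ENNReal.ofReal (∏ t, G t (past x t) (z t)) := by
    intro x z
    rw [ENNReal.ofReal_prod_of_nonneg fun t _ => hG0 _ _ _]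
    exact Finset.prod_congr rfl fun t _ => (ENNReal.ofReal_toReal ((Γ t _).apply_ne_top _)).symm
  have hw0 : ∀ x z, 0 ≤ pathWeight (fun t => q (c t m)) G x z := fun x z =>
    Finset.prod_nonneg fun t _ => mul_nonneg (hq _ _).le (hG0 _ _ _)
  have hweight : ∀ x z, (coinCode q hq hq1 c N d).enc m x * stateProb Γ x z =
      ENNReal.ofReal (pathWeight (fun t => q (c t m)) G x z) := by
    intro x z
    rw [hstate, pathWeight, Finset.prod_mul_distrib,
      ENNReal.ofReal_mul (Finset.prod_nonneg fun t _ => (hq _ _).le)]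
    rfl
  have hpt : ∀ x z, (if (coinCode q hq hq1 c N d).dec (output x z) ≠ some m
      then (coinCode q hq hq1 c N d).enc m x * stateProb Γ x z else 0) ≤
      ENNReal.ofReal (pathWeight (fun t => q (c t m)) G x z *
          (if Plausible q c N d x z m then 0 else 1) +
        pathWeight (fun t => q (c t m)) G x z *
          (if N + 2 * d + cost z ≤ n ∧ ∃ m' ≠ m, Plausible q c N d x z m' ∧
          lik q (fun t => c t m) (tail N z n) x ≤ lik q (fun t => c t m') (tail N z n) x
          then 1 else 0)) := by
    intro x z
    by_cases hdec : (coinCode q hq hq1 c N d).dec (output x z) ≠ some m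
    swap
    · rw [if_neg hdec]; exact zero_le
    rw [if_pos hdec]
    -- The bound on the number of erasures holds only on the support of the strategy.
    by_cases hz : stateProb Γ x z = 0
    · rw [hz, mul_zero]; exact zero_le
    rw [hweight]
    refine ENNReal.ofReal_le_ofReal ?_
    have hcost : N + 2 * d + cost z ≤ n := by
      have := hΓ x z hz
      have : ((N + 2 * d + cost z : ℕ) : ℝ) ≤ n := by
        push_cast
        linarith
      exact_mod_cast this
    have hwins : ¬ Wins q c N d x z m := fun h => hdec (decode_output h)
    by_cases hpl : Plausible q c N d x z m
    · have hex : ∃ m' ≠ m, Plausible q c N d x z m' ∧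
          lik q (fun t => c t m) (tail N z n) x ≤ lik q (fun t => c t m') (tail N z n) x := by
        by_contra! hcon
        exact hwins ⟨hpl, hcon⟩
      rw [if_pos hpl, if_pos ⟨hcost, hex⟩]
      linarith
    · rw [if_neg hpl, mul_one]
      have : 0 ≤ pathWeight (fun t => q (c t m)) G x z *
          (if N + 2 * d + cost z ≤ n ∧ ∃ m' ≠ m, Plausible q c N d x z m' ∧
          lik q (fun t => c t m) (tail N z n) x ≤ lik q (fun t => c t m') (tail N z n) x
          then 1 else 0) := by
        refine mul_nonneg (hw0 x z) ?_
        split_ifs <;> norm_num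
      linarith
  have h0 : ∀ x z, 0 ≤ pathWeight (fun t => q (c t m)) G x z *
          (if Plausible q c N d x z m then 0 else 1) +
        pathWeight (fun t => q (c t m)) G x z *
          (if N + 2 * d + cost z ≤ n ∧ ∃ m' ≠ m, Plausible q c N d x z m' ∧
          lik q (fun t => c t m) (tail N z n) x ≤ lik q (fun t => c t m') (tail N z n) x
          then 1 else 0) := by
    intro x z
    refine add_nonneg (mul_nonneg (hw0 x z) ?_) (mul_nonneg (hw0 x z) ?_) <;>
      split_ifs <;> norm_num
  rw [errorProb_eq]
  refine (Finset.sum_le_sum fun x _ => Finset.sum_le_sum fun z _ => hpt x z).trans ?_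
  simp_rw [← ENNReal.ofReal_sum_of_nonneg fun z _ => h0 _ z]
  rw [← ENNReal.ofReal_sum_of_nonneg fun x _ => Finset.sum_nonneg fun z _ => h0 x z]
  refine ENNReal.ofReal_le_ofReal ?_
  simp_rw [Finset.sum_add_distrib]
  refine add_le_add (sum_implausible_le hq hq1 hG0 hG1 hσ1 hσ c N d m)
    (sum_rival_le hq hq1 hG0 hG1 hρ0 hρ1 hρ c hN ?_ ?_ m)
  · convert hagree
  · convert hlist

/-! ### An alphabet of coins -/

/-- The coin with letter `(s, j)` shows `s`, except with the small probability `ε / (j + 2)`. -/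
def coin (ε : ℝ) {K : ℕ} (a : Bool × Fin K) (b : Bool) : ℝ :=
  if b = a.1 then 1 - ε / ((a.2 : ℕ) + 2) else ε / ((a.2 : ℕ) + 2)

section Coin
variable {ε : ℝ} {K : ℕ}

lemma coin_bias_pos (h0 : 0 < ε) (j : Fin K) : 0 < ε / ((j : ℕ) + 2 : ℝ) := by positivity

lemma coin_bias_lt (h0 : 0 < ε) (h1 : ε < 1) (j : Fin K) : ε / ((j : ℕ) + 2 : ℝ) < 1 / 2 := by
  have hj : (0 : ℝ) ≤ (j : ℕ) := Nat.cast_nonneg _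
  rw [div_lt_div_iff₀ (by linarith) (by norm_num)]
  linarith

lemma coin_pos (h0 : 0 < ε) (h1 : ε < 1) (a : Bool × Fin K) (b : Bool) : 0 < coin ε a b := by
  have := coin_bias_pos h0 a.2
  have := coin_bias_lt h0 h1 a.2
  unfold coin
  split_ifs <;> linarith

lemma sum_coin (a : Bool × Fin K) : ∑ b, coin ε a b = 1 := by
  rcases a with ⟨_ | _, j⟩ <;> simp [coin]

lemma sum_coin_letters (b : Bool) :
    ∑ a : Bool × Fin K, coin ε a b = Fintype.card (Bool × Fin K) / 2 := by
  rw [Fintype.sum_prod_type, Fintype.sum_bool, ← Finset.sum_add_distrib]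
  cases b <;> simp [coin]

lemma coin_injective (h0 : 0 < ε) (h1 : ε < 1) :
    Function.Injective (coin ε : Bool × Fin K → Bool → ℝ) := by
  rintro ⟨s, i⟩ ⟨s', j⟩ h
  have hi := coin_bias_lt h0 h1 i
  have hj := coin_bias_lt h0 h1 j
  have h' := congrFun h s
  simp only [coin, if_true] at h'
  by_cases hs : s = s'
  · subst hs
    simp only [if_true] at h'
    have h2 : ε / ((i : ℕ) + 2 : ℝ) = ε / ((j : ℕ) + 2 : ℝ) := by linarith
    rw [div_eq_div_iff (by positivity) (by positivity)] at h2
    have h3 : ((j : ℕ) : ℝ) + 2 = (i : ℕ) + 2 := mul_left_cancel₀ h0.ne' h2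
    have h4 : ((j : ℕ) : ℝ) = (i : ℕ) := by linarith
    have h5 : i = j := Fin.ext (by exact_mod_cast h4.symm)
    rw [h5]
  · rw [if_neg hs] at h'
    linarith

lemma sum_sqrt_coin_le (h0 : 0 < ε) (h1 : ε < 1) (a : Bool × Fin K) :
    ∑ b, √(coin ε a b) ≤ 1 + √ε := by
  have hj := coin_bias_pos h0 a.2
  have hlt := coin_bias_lt h0 h1 a.2
  have hle : ε / ((a.2 : ℕ) + 2 : ℝ) ≤ ε :=
    div_le_self h0.le (by have : (0 : ℝ) ≤ (a.2 : ℕ) := Nat.cast_nonneg _; linarith)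
  have hs1 : √(1 - ε / ((a.2 : ℕ) + 2 : ℝ)) ≤ 1 := Real.sqrt_le_one.2 (by linarith)
  have hs2 := Real.sqrt_le_sqrt hle
  rcases a with ⟨_ | _, j⟩ <;>
    simp only [coin, Fintype.sum_bool, if_true, reduceCtorEq, if_false] <;> linarith

/-- The Bhattacharyya coefficient of two different coins is less than `1`. -/
lemma sum_sqrt_mul_sqrt_lt_one {f g : Bool → ℝ} (hf : ∀ b, 0 ≤ f b) (hg : ∀ b, 0 ≤ g b)
    (hf1 : ∑ b, f b = 1) (hg1 : ∑ b, g b = 1) (hne : f ≠ g) : ∑ b, √(f b) * √(g b) < 1 := by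
  obtain ⟨b, hb⟩ := Function.ne_iff.1 hne
  have hsq : ∑ b, (√(f b) - √(g b)) ^ 2 = 2 - 2 * ∑ b, √(f b) * √(g b) := by
    have : ∀ b, (√(f b) - √(g b)) ^ 2 = f b + g b - 2 * (√(f b) * √(g b)) := by
      intro b
      rw [sub_sq, Real.sq_sqrt (hf b), Real.sq_sqrt (hg b)]
      ring
    simp_rw [this, Finset.sum_sub_distrib, Finset.sum_add_distrib, hf1, hg1, Finset.mul_sum]
    norm_num
  have hpos : 0 < ∑ b, (√(f b) - √(g b)) ^ 2 := by
    refine Finset.sum_pos' (fun b _ => sq_nonneg _) ⟨b, Finset.mem_univ b, ?_⟩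
    have : √(f b) - √(g b) ≠ 0 := by
      rw [sub_ne_zero]
      intro h
      exact hb ((Real.sqrt_inj (hf b) (hg b)).1 h)
    positivity
  linarith

lemma exists_bhattacharyya_bound (h0 : 0 < ε) (h1 : ε < 1) (K : ℕ) :
    ∃ ρ : ℝ, 0 < ρ ∧ ρ < 1 ∧ ∀ a a' : Bool × Fin K, a ≠ a' →
      ∑ b, √(coin ε a b) * √(coin ε a' b) ≤ ρ := by
  have hpair : ∀ᶠ ρ in nhdsWithin (1 : ℝ) (Set.Iio 1), ∀ a a' : Bool × Fin K, a ≠ a' →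
      ∑ b, √(coin ε a b) * √(coin ε a' b) ≤ ρ := by
    refine Filter.eventually_all.2 fun a => Filter.eventually_all.2 fun a' => ?_
    by_cases h : a = a'
    · exact Filter.Eventually.of_forall fun _ h' => absurd h h'
    · have hlt := sum_sqrt_mul_sqrt_lt_one (fun b => (coin_pos h0 h1 a b).le)
        (fun b => (coin_pos h0 h1 a' b).le) (sum_coin a) (sum_coin a')
        fun he => h (coin_injective h0 h1 he)
      filter_upwards [Ico_mem_nhdsLT hlt] with ρ hρ _ using hρ.1
  obtain ⟨ρ, hρ, hρ01⟩ := (hpair.and (Ioo_mem_nhdsLT (zero_lt_one' ℝ))).exists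
  exact ⟨ρ, hρ01.1, hρ01.2, hρ⟩

end Coin

/-! ### Rates below capacity -/

/-- There is room for a probability of flipping a coin so small that `n ≤ κ * d` coins are of
total entropy well below `d`. -/
lemma exists_bias (κ : ℕ) : ∃ ε : ℝ, 0 < ε ∧ ε < 1 ∧ (1 + √ε) ^ κ * √(1 / 2) < 1 := by
  have hcont : ContinuousAt (fun ε : ℝ => (1 + √ε) ^ κ * √(1 / 2)) 0 := by fun_prop
  have hlt : (fun ε : ℝ => (1 + √ε) ^ κ * √(1 / 2)) 0 < 1 := by
    simp only [Real.sqrt_zero, add_zero, one_pow, one_mul]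
    rw [Real.sqrt_lt' one_pos]
    norm_num
  have hev := (hcont.eventually (Iio_mem_nhds hlt)).filter_mono
    (nhdsWithin_le_nhds (s := Set.Ioi 0))
  obtain ⟨ε, hε, hε01⟩ := (hev.and (Ioo_mem_nhdsGT (zero_lt_one' ℝ))).exists
  exact ⟨ε, hε01.1, hε01.2, hε⟩

/-- The first-moment bound of `exists_code` for `2 ^ r` messages, heads of length `r + 2 * d` and
lists of length `2 * κ + 1`. -/
lemma firstMoment_lt_one {n r d κ : ℕ} {α : ℝ} (hr : r ≤ n) (hd : 1 ≤ d) (hn : n ≤ κ * d)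
    (hα : (2 : ℝ) ^ (3 * κ + 2) ≤ α) :
    ((2 ^ r : ℕ) : ℝ) * (2 ^ r : ℕ) * (2 ^ n / α ^ (d + 1)) +
      2 ^ n * 2 ^ n * (((2 ^ r : ℕ) : ℝ) ^ (2 * κ + 1 + 1) *
        (2 ^ d * (1 / 2) ^ (r + 2 * d)) ^ (2 * κ + 1 + 1)) < 1 := by
  have h12 : (1 : ℝ) ≤ 2 := one_le_two
  have hα1 : (1 : ℝ) ≤ α := (one_le_pow₀ h12).trans hα
  have hα0 : (0 : ℝ) < α := by linarith
  push_cast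
  have hfirst : (2 : ℝ) ^ r * 2 ^ r * (2 ^ n / α ^ (d + 1)) ≤ 1 / 4 := by
    rw [mul_div_assoc', div_le_iff₀ (by positivity)]
    have h1 : (2 : ℝ) ^ (3 * κ * d + 2) ≤ α ^ (d + 1) := by
      calc (2 : ℝ) ^ (3 * κ * d + 2) ≤ 2 ^ ((3 * κ + 2) * (d + 1)) :=
            pow_le_pow_right₀ h12 (by nlinarith)
        _ = (2 ^ (3 * κ + 2)) ^ (d + 1) := pow_mul _ _ _
        _ ≤ _ := by gcongr
    have h2 : (2 : ℝ) ^ r * 2 ^ r * 2 ^ n ≤ 2 ^ (3 * κ * d) := by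
      rw [← pow_add, ← pow_add]
      exact pow_le_pow_right₀ h12 (by nlinarith)
    rw [pow_add] at h1
    linarith
  have hsecond : (2 : ℝ) ^ n * 2 ^ n * (((2 : ℝ) ^ r) ^ (2 * κ + 1 + 1) *
        (2 ^ d * (1 / 2) ^ (r + 2 * d)) ^ (2 * κ + 1 + 1)) ≤ 1 / 4 := by
    have h1 : (2 : ℝ) ^ r * (2 ^ d * (1 / 2) ^ (r + 2 * d)) = (1 / 2) ^ d := by
      have h2 : ∀ k : ℕ, (2 : ℝ) ^ k * (1 / 2) ^ k = 1 := fun k => by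
        rw [← mul_pow]; norm_num
      calc (2 : ℝ) ^ r * (2 ^ d * (1 / 2) ^ (r + 2 * d))
          = (2 ^ r * (1 / 2) ^ r) * (2 ^ d * (1 / 2) ^ d) * (1 / 2) ^ d := by ring
        _ = _ := by rw [h2, h2]; ring
    rw [← mul_pow (2 ^ r : ℝ), h1, ← pow_mul, ← pow_add, one_div_pow, mul_one_div,
      div_le_div_iff₀ (by positivity) (by norm_num), one_mul]
    calc (2 : ℝ) ^ (n + n) * 4 = 2 ^ (n + n + 2) := by rw [pow_add _ (n + n)]; norm_num
      _ ≤ _ := pow_le_pow_right₀ h12 (by nlinarith)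
  linarith

/-- With the gap `g = 1 - p - R` and `d ≈ n g / 4`, the `n R + 4 d` unerased bits are split into a
head of `n R + 2 d` bits, of which `2 d` are the slack for short lists of plausible messages, and a
tail of `2 d` bits, of which at most `d` fail to distinguish two given messages. -/
theorem mem_achievableRates {p R : ℝ} (hp0 : 0 ≤ p) (hR0 : 0 ≤ R) (hR : R < 1 - p) :
    R ∈ achievableRates p := by
  set g : ℝ := 1 - p - R with hg
  have hg0 : 0 < g := by linarith
  -- From `n ≥ κ` on, rounding down costs `d` at most a factor `2`, so that `n ≤ κ * d`.
  set κ : ℕ := ⌈8 / g⌉₊ with hκ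
  have hκg : 8 ≤ κ * g := (div_le_iff₀ hg0).1 (Nat.le_ceil _)
  obtain ⟨ε, hε0, hε1, hε⟩ := exists_bias κ
  obtain ⟨ρ, hρ0, hρ1, hρ⟩ := exists_bhattacharyya_bound hε0 hε1 (2 ^ (3 * κ + 1))
  set β : ℝ := (1 + √ε) ^ κ * √(1 / 2) with hβ
  have hβ0 : 0 ≤ β := by positivity
  let d : ℕ → ℕ := fun n => ⌊(n : ℝ) * g / 4⌋₊
  have hcode : ∀ n, ∃ C : StochasticCode n (2 ^ ⌊(n : ℝ) * R⌋₊), κ ≤ n →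
      maxErrorProb p C ≤ ENNReal.ofReal (β ^ d n + (2 * κ + 1 : ℕ) * ρ ^ d n) := by
    intro n
    by_cases hn : κ ≤ n
    swap
    -- Small blocklengths do not matter, and any code will do.
    · exact ⟨⟨fun _ => PMF.pure fun _ => false, fun _ => none⟩, fun h => absurd h hn⟩
    have hng : 8 ≤ n * g :=
      hκg.trans (mul_le_mul_of_nonneg_right (by exact_mod_cast hn) hg0.le)
    have hd1 : (d n : ℝ) ≤ n * g / 4 := Nat.floor_le (by linarith)
    have hd2 : (n : ℝ) * g / 4 < d n + 1 := Nat.lt_floor_add_one _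
    have hdpos : 1 ≤ d n := by
      have : (0 : ℝ) < d n := by linarith
      exact_mod_cast this
    have hnd : n ≤ κ * d n := by
      have h1 : (n : ℝ) * g / 8 ≤ d n := by linarith
      have h2 : (n : ℝ) ≤ κ * d n := by
        calc (n : ℝ) ≤ n * (κ * g / 8) := by
              refine le_mul_of_one_le_right (Nat.cast_nonneg n) ?_
              linarith
          _ = κ * (n * g / 8) := by ring
          _ ≤ κ * d n := by gcongr
      exact_mod_cast h2
    set r : ℕ := ⌊(n : ℝ) * R⌋₊ with hr
    have hr1 : (r : ℝ) ≤ n * R := Nat.floor_le (by positivity)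
    have hsum : (r : ℝ) + 4 * d n ≤ (1 - p) * n := by
      have : (1 - p) * n = n * R + n * g := by rw [hg]; ring
      linarith
    have hrn : r ≤ n := by
      have hn0 : (0 : ℝ) ≤ n := Nat.cast_nonneg n
      have hd0 : (0 : ℝ) ≤ d n := Nat.cast_nonneg _
      have : (r : ℝ) ≤ n := by nlinarith
      exact_mod_cast this
    have hcard : (2 : ℝ) ^ (3 * κ + 2) ≤ (Fintype.card (Bool × Fin (2 ^ (3 * κ + 1))) : ℝ) := by
      simp [pow_succ]
      linarith
    obtain ⟨c, hagree, hlist⟩ := exists_code (A := Bool × Fin (2 ^ (3 * κ + 1))) (coin ε)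
      (fun a b => (coin_pos hε0 hε1 a b).le) sum_coin_letters n (2 ^ r) (r + 2 * d n) (d n)
      (2 * κ + 1) (firstMoment_lt_one hrn hdpos hnd hcard)
    refine ⟨coinCode (coin ε) (coin_pos hε0 hε1) sum_coin c (r + 2 * d n) (d n), fun _ => ?_⟩
    have hσ1 : 1 ≤ 1 + √ε := by linarith [Real.sqrt_nonneg ε]
    refine (maxErrorProb_coinCode_le (coin_pos hε0 hε1) sum_coin hσ1 (sum_sqrt_coin_le hε0 hε1)
      hρ0 hρ1.le hρ c (by omega) hagree hlist ?_).trans (ENNReal.ofReal_le_ofReal ?_)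
    · push_cast
      linarith
    · refine add_le_add ?_ le_rfl
      rw [hβ, mul_pow, ← pow_mul]
      gcongr
  choose C hC using hcode
  refine ⟨hR0, C, ?_⟩
  have hdtop : Filter.Tendsto d Filter.atTop Filter.atTop := by
    refine tendsto_nat_floor_atTop.comp ?_
    have := tendsto_natCast_atTop_atTop (R := ℝ).atTop_mul_const (by positivity : 0 < g / 4)
    simpa [mul_div_assoc] using this
  have hlim : Filter.Tendsto
      (fun n => ENNReal.ofReal (β ^ d n + (2 * κ + 1 : ℕ) * ρ ^ d n)) Filter.atTop (nhds 0) := by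
    have h1 := (tendsto_pow_atTop_nhds_zero_of_lt_one hβ0 hε).comp hdtop
    have h2 := ((tendsto_pow_atTop_nhds_zero_of_lt_one hρ0.le hρ1).comp hdtop).const_mul
      ((2 * κ + 1 : ℕ) : ℝ)
    have h3 := ENNReal.tendsto_ofReal (h1.add h2)
    simpa using h3
  refine tendsto_of_tendsto_of_tendsto_of_le_of_le' tendsto_const_nhds hlim
    (Filter.Eventually.of_forall fun _ => zero_le) ?_
  filter_upwards [Filter.eventually_ge_atTop κ] with n hn using hC n hn

end OneBitDelay
end

theorem theorem1 (p : ℝ) (hp0 : 0 ≤ p) (hp1 : p ≤ 1) :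
    OneBitDelay.IsCapacity p (1 - p) := by
  refine ⟨fun R hR => OneBitDelay.achievableRates_le hp0 hp1 hR, fun b hb => ?_⟩
  -- The rate `0` settles the case `p = 1`, in which no rate lies below `1 - p`.
  have hb0 : 0 ≤ b := hb (OneBitDelay.zero_mem_achievableRates p)
  refine le_of_forall_lt fun R hR => ?_
  rcases lt_or_ge R 0 with hneg | hR0
  · exact hneg.trans_le hb0
  obtain ⟨R', h1, h2⟩ := exists_between hR
  exact h1.trans_le (hb (OneBitDelay.mem_achievableRates hp0 (hR0.trans h1.le) h2))
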